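/- Let $X$ be a real vector space with a metric $d$ that induces a vector space topology (addition and scalar multiplication are continuous) and for which affine lines $t\mapsto p+tv$ are locally Lipschitz (for instance, $d$ comes from a norm). Let $(X,d,\ll,\le,\tau)$ be a Lorentzian pre-length space: $\le$ is reflexive and transitive, $\ll$ is transitive and contained in $\le$, and the time separation $\tau:X\times X\to[0,\infty]$ is lower semicontinuous, satisfies $\tau(x,z)\ge\tau(x,y)+\tau(y,z)$ for $x\le y\le z$, vanishes on $(x,y)$ if $x\not\le y$, and satisfies $\tau(x,y)>0\Leftrightarrow x\ll y$. Suppose that $\tau$ is translation invariant, $\tau(x+z,y+z)=\tau(x,y)$, and that $\tau(0,\cdot)$ is positively homogeneous, $\tau(0,cx)=c\,\tau(0,x)$ for $c>0$. Suppose that there are $x,y\in X$ with $0\ll x$, $0\ll y$, $0\ll x+y$, $0\ll x-y$ and $$2\tau(0,x)^2+2\tau(0,y)^2\neq\tau(0,x+y)^2+\tau(0,x-y)^2 .$$ Then for no $K\in\mathbb R$ does $(X,\tau)$ have timelike sectional curvature bounded below by $K$ or bounded above by $K$, in the sense of triangle comparison; and in fact for every $K\in\mathbb R$ and every non-empty open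 set $U\subset X$ the triangle comparison condition (3) below fails in $U$, both for the lower bound $K$ and for the upper bound $K$. Here the timelike curvature is bounded below (above) by $K$ if every point of $X$ has an open neighbourhood $U$ such that, with $D_K=\pi/\sqrt{-K}$ for $K<0$ and $D_K=\infty$ for $K\ge0$, (1) the set $\{(p,q)\in U\times U:\tau(p,q)<D_K\}$ is open and $\tau$ is continuous on it; (2) any $p\ll q$ in $U$ with $\tau(p,q)<D_K$ are joined by a distance realizer in $U$, that is, a future-directed causal Lipschitz curve in $U$ whose $\tau$-length is $\tau(p,q)$; (3) for every timelike triangle in $U$ (vertices $a\ll b\ll c$ with $\tau(a,c)<D_K$, and distance realizers in $U$ as sides), every vertex $v$ and every point $m$ of the side opposite to $v$, and for every comparison triangle in the simply connected Lorentzian surface of constant curvature $K$ (de Sitter, Minkowski or anti-de Sitter for $K>0$, $K=0$, $K<0$), i.e. one with the same side lengths, and comparison point $\bar m$, i.e. the point of the corresponding side with the same time separations from the adjacent vertices, one has $\tau(v,m)\le\bar\tau(\bar v,\bar m)$ and $\tau(m,v)\le\bar\tau(\bar m,\bar v)$ (respectively $\ge$ in both). -/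

import Mathlib

open scoped ENNReal Topology

noncomputable section

/-- A Lorentzian pre-length space structure `(≪, ≤, τ)` on a metric space `X`.
The relation `≪` is `ll`, the relation `≤` is `cle`. -/
structure LorentzianPreLengthSpace (X : Type*) [MetricSpace X] where
  /-- the chronological relation `≪` -/
  ll : X → X → Prop
  /-- the causal relation `≤` -/
  cle : X → X → Prop
  /-- the time separation function -/
  τ : X → X → ℝ≥0∞
  cle_refl : ∀ x, cle x x
  cle_trans : ∀ x y z, cle x y → cle y z → cle x z
  ll_trans : ∀ x y z, ll x y → ll y z → ll x z
  cle_of_ll : ∀ x y, ll x y → cle x y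
  lowerSemicontinuous_τ : LowerSemicontinuous (fun q : X × X => τ q.1 q.2)
  reverse_triangle : ∀ x y z, cle x y → cle y z → τ x y + τ y z ≤ τ x z
  τ_eq_zero : ∀ x y, ¬ cle x y → τ x y = 0
  τ_pos_iff : ∀ x y, 0 < τ x y ↔ ll x y

/-! ### The comparison spaces

All three are described on `ℝ × ℝ`; for `p = (t, x)` the coordinate `t` is the time coordinate. -/

/-- Time separation of the Minkowski plane, with the metric `-dt² + dx²`. -/
def minkowskiTau (p q : ℝ × ℝ) : ℝ≥0∞ :=
  open Classical in
  if |q.2 - p.2| < q.1 - p.1 then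
    ENNReal.ofReal (Real.sqrt ((q.1 - p.1) ^ 2 - (q.2 - p.2) ^ 2))
  else 0

/-- `⟨P, Q⟩ / r²` for the points `P, Q` of the de Sitter quadric `-X₀² + X₁² + X₂² = r²`
with global coordinates `p, q`, where `(t, x) ↦ r (sinh t, cosh t cos x, cosh t sin x)`. -/
def deSitterProd (p q : ℝ × ℝ) : ℝ :=
  Real.cosh p.1 * Real.cosh q.1 * Real.cos (q.2 - p.2) - Real.sinh p.1 * Real.sinh q.1

/-- Time separation of the simply connected two-dimensional de Sitter space of radius `r`, with
the metric `r² (-dt² + cosh² t dx²)` on `ℝ × ℝ`: the point `q` is in the chronological future of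
`p` iff it is later, less than half a turn away and `⟨P, Q⟩ > r²`, and then the time separation
is the length `r * arcosh (⟨P, Q⟩ / r²)` of the geodesic from `p` to `q`. -/
def deSitterTau (r : ℝ) (p q : ℝ × ℝ) : ℝ≥0∞ :=
  open Classical in
  if p.1 < q.1 ∧ |q.2 - p.2| < Real.pi ∧ 1 < deSitterProd p q then
    ENNReal.ofReal (r * Real.arcosh (deSitterProd p q))
  else 0

/-- `-⟨P, Q⟩ / r²` for the points `P, Q` of the anti-de Sitter quadric `-X₀² - X₁² + X₂² = -r²`
with global coordinates `p, q`, where `(t, x) ↦ r (cosh x cos t, cosh x sin t, sinh x)`. -/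
def antiDeSitterProd (p q : ℝ × ℝ) : ℝ :=
  Real.cosh p.2 * Real.cosh q.2 * Real.cos (q.1 - p.1) - Real.sinh p.2 * Real.sinh q.2

/-- Time separation of the simply connected two-dimensional anti-de Sitter space of radius `r`,
with the metric `r² (-cosh² x dt² + dx²)` on `ℝ × ℝ`. If the time coordinate increases by
`s ∈ (0, π]`, then `q` is in the chronological future of `p` iff `-⟨P, Q⟩ < r²`, and the time
separation is `r * arccos (-⟨P, Q⟩ / r²)`, or infinite where this makes no sense (causal curves
from `p` to `q` can then come arbitrarily close to infinity, and their lengths are unbounded).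
For `s > π` it is infinite as well. -/
def antiDeSitterTau (r : ℝ) (p q : ℝ × ℝ) : ℝ≥0∞ :=
  open Classical in
  if q.1 ≤ p.1 ∨ (q.1 - p.1 ≤ Real.pi ∧ 1 ≤ antiDeSitterProd p q) then 0
  else if q.1 - p.1 ≤ Real.pi ∧ -1 ≤ antiDeSitterProd p q then
    ENNReal.ofReal (r * Real.arccos (antiDeSitterProd p q))
  else ⊤

/-- Time separation of the simply connected Lorentzian surface of constant curvature `K`:
de Sitter space for `K > 0`, the Minkowski plane for `K = 0`, anti-de Sitter space for `K < 0`. -/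
def modelTau (K : ℝ) (p q : ℝ × ℝ) : ℝ≥0∞ :=
  open Classical in
  if 0 < K then deSitterTau (1 / Real.sqrt K) p q
  else if K < 0 then antiDeSitterTau (1 / Real.sqrt (-K)) p q
  else minkowskiTau p q

/-- The (finite) timelike diameter `D_K` of the comparison space: `π / √(-K)` for `K < 0`, and
`∞` for `K ≥ 0`. -/
def modelDiam (K : ℝ) : ℝ≥0∞ :=
  open Classical in
  if K < 0 then ENNReal.ofReal (Real.pi / Real.sqrt (-K)) else ⊤

/-- `m` lies on the timelike geodesic segment from `p` to `q` (for `p ≪ q` within the timelike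
diameter) of the comparison space: it is an endpoint, or it lies chronologically between the
endpoints and the time separations add up. -/
def ModelSegment (K : ℝ) (p q m : ℝ × ℝ) : Prop :=
  m = p ∨ m = q ∨
    (0 < modelTau K p m ∧ 0 < modelTau K m q ∧
      modelTau K p m + modelTau K m q = modelTau K p q)

namespace LorentzianPreLengthSpace

variable {X : Type*} [MetricSpace X] (S : LorentzianPreLengthSpace X)

/-- `γ`, restricted to `[0, 1]`, is a future-directed causal curve: non-constant, Lipschitz and
increasing with respect to the causal relation. -/
def IsCausalCurve (γ : ℝ → X) : Prop :=
  (∃ C, LipschitzOnWith C γ (Set.Icc 0 1)) ∧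
  (∃ s ∈ Set.Icc (0 : ℝ) 1, ∃ t ∈ Set.Icc (0 : ℝ) 1, γ s ≠ γ t) ∧
  ∀ s ∈ Set.Icc (0 : ℝ) 1, ∀ t ∈ Set.Icc (0 : ℝ) 1, s < t → S.cle (γ s) (γ t)

/-- The `τ`-length of `γ` on `[0, 1]`: the infimum over all partitions `0 = t₀ < ⋯ < tₙ = 1` of
the sum of the time separations of consecutive points. -/
def tauLength (γ : ℝ → X) : ℝ≥0∞ :=
  ⨅ (n : ℕ) (t : ℕ → ℝ) (_ : t 0 = 0) (_ : t n = 1) (_ : ∀ i < n, t i < t (i + 1)),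
    ∑ i ∈ Finset.range n, S.τ (γ (t i)) (γ (t (i + 1)))

/-- `γ` is a distance realizer (geodesic) from `x` to `y` that stays in `U`. -/
def IsRealizerIn (U : Set X) (x y : X) (γ : ℝ → X) : Prop :=
  S.IsCausalCurve γ ∧ γ 0 = x ∧ γ 1 = y ∧ (∀ s ∈ Set.Icc (0 : ℝ) 1, γ s ∈ U) ∧
    S.tauLength γ = S.τ x y

/-- A timelike geodesic triangle in `U` that satisfies the size bounds for `K`: vertices
`a ≪ b ≪ c` with `τ(a, c) < D_K`, with distance realizers `ab`, `bc`, `ac` as sides. -/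
structure IsTimelikeTriangle (K : ℝ) (U : Set X) (a b c : X) (ab bc ac : ℝ → X) : Prop where
  ll_ab : S.ll a b
  ll_bc : S.ll b c
  size : S.τ a c < modelDiam K
  side_ab : S.IsRealizerIn U a b ab
  side_bc : S.IsRealizerIn U b c bc
  side_ac : S.IsRealizerIn U a c ac

/-- `(a', b', c')` is a comparison triangle in the space of curvature `K` for `(a, b, c)`. -/
def IsComparisonTriangle (K : ℝ) (a b c : X) (a' b' c' : ℝ × ℝ) : Prop :=
  modelTau K a' b' = S.τ a b ∧ modelTau K b' c' = S.τ b c ∧ modelTau K a' c' = S.τ a c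

/-- `m'` is the comparison point on the segment from `p'` to `q'` for the point `m` of a side
from `p` to `q`: it has the same time separations from the two adjacent vertices. -/
def IsComparisonPoint (K : ℝ) (p q m : X) (p' q' m' : ℝ × ℝ) : Prop :=
  ModelSegment K p' q' m' ∧ modelTau K p' m' = S.τ p m ∧ modelTau K m' q' = S.τ m q

/-- The vertex `v` and the point `m` of the side `γ` from `p` to `q` opposite to `v` occur, with
their comparison points `v'` and `m'`, in a timelike triangle in `U` satisfying the size bounds
for `K`. The three cases are those of the three vertices of the triangle. -/
def IsComparisonPair (K : ℝ) (U : Set X) (v m : X) (v' m' : ℝ × ℝ) : Prop :=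
  ∃ (a b c : X) (ab bc ac : ℝ → X) (a' b' c' : ℝ × ℝ),
    S.IsTimelikeTriangle K U a b c ab bc ac ∧ S.IsComparisonTriangle K a b c a' b' c' ∧
    ((v = a ∧ v' = a' ∧ m ∈ bc '' Set.Icc 0 1 ∧ S.IsComparisonPoint K b c m b' c' m') ∨
     (v = b ∧ v' = b' ∧ m ∈ ac '' Set.Icc 0 1 ∧ S.IsComparisonPoint K a c m a' c' m') ∨
     (v = c ∧ v' = c' ∧ m ∈ ab '' Set.Icc 0 1 ∧ S.IsComparisonPoint K a b m a' b' m'))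

/-- Triangle comparison in `U` for curvature bounded below by `K`: time separations between a
vertex and a point of the opposite side are at most those in the comparison triangle. -/
def TriangleComparisonBelow (K : ℝ) (U : Set X) : Prop :=
  ∀ (v m : X) (v' m' : ℝ × ℝ), S.IsComparisonPair K U v m v' m' →
    S.τ v m ≤ modelTau K v' m' ∧ S.τ m v ≤ modelTau K m' v'

/-- Triangle comparison in `U` for curvature bounded above by `K`: time separations between a
vertex and a point of the opposite side are at least those in the comparison triangle. -/
def TriangleComparisonAbove (K : ℝ) (U : Set X) : Prop :=
  ∀ (v m : X) (v' m' : ℝ × ℝ), S.IsComparisonPair K U v m v' m' →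
    modelTau K v' m' ≤ S.τ v m ∧ modelTau K m' v' ≤ S.τ m v

/-- The regularity requirements on a comparison neighbourhood: the set of pairs in `U` of time
separation less than `D_K` is open, `τ` is continuous on it, and any two points `x ≪ y` of `U`
with `τ(x, y) < D_K` are joined by a distance realizer in `U`. -/
def IsRegularIn (K : ℝ) (U : Set X) : Prop :=
  IsOpen {q : X × X | q.1 ∈ U ∧ q.2 ∈ U ∧ S.τ q.1 q.2 < modelDiam K} ∧
  ContinuousOn (fun q : X × X => S.τ q.1 q.2)
    {q : X × X | q.1 ∈ U ∧ q.2 ∈ U ∧ S.τ q.1 q.2 < modelDiam K} ∧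
  ∀ x ∈ U, ∀ y ∈ U, S.ll x y → S.τ x y < modelDiam K → ∃ γ, S.IsRealizerIn U x y γ

/-- The timelike (sectional) curvature is bounded below by `K`: every point has a comparison
neighbourhood. -/
def CurvatureBoundedBelow (K : ℝ) : Prop :=
  ∀ p : X, ∃ U : Set X, IsOpen U ∧ p ∈ U ∧ S.IsRegularIn K U ∧ S.TriangleComparisonBelow K U

/-- The timelike (sectional) curvature is bounded above by `K`: every point has a comparison
neighbourhood. -/
def CurvatureBoundedAbove (K : ℝ) : Prop :=
  ∀ p : X, ∃ U : Set X, IsOpen U ∧ p ∈ U ∧ S.IsRegularIn K U ∧ S.TriangleComparisonAbove K U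

end LorentzianPreLengthSpace

end

/-!
The obstruction is the parallelogram law. Write `f = τ(0, ·)`. Affine segments with timelike
direction are distance realizers (`isRealizerIn_line`), so for `u ∈ U` and small `ε > 0` the points
`u`, `u + ε (x - y)`, `u + ε (x + y)` span a timelike triangle in `U`, with sides
`ε f(x - y)`, `2 ε f(y)`, `ε f(x + y)`; the median at `u` ends at `u + ε x` and has length `ε f(x)`.

In the space of constant curvature `K` a comparison triangle is written down in coordinates; the
median `μ` of a triangle with sides `p - q`, `p + q` at the vertex and `2 s` opposite to it is given
by `cosh μ cosh s = cosh p cosh q` (`K = 1`), `μ² + s² = p² + q²` (`K = 0`) and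
`cos μ cos s = cos p cos q` (`K = -1`). Up to second order in the size of the triangle these three
agree (`eventually_lt_median`, `eventually_median_lt`), so for small `ε` and any `K` the comparison
median is longer or shorter than `ε f(x)` according to whether `2 f(x)² + 2 f(y)²` is
less or greater than `f(x + y)² + f(x - y)²`.

Replacing `(x, y)` by `(x + y, x - y)` doubles one side of the parallelogram law and interchanges it
with the other, so it reverses the inequality. Hence one strict inequality makes both triangle
comparisons fail, whatever `K` is (`exists_isComparisonPair_lt_and_gt`).
-/

open Filter

/-! ### Medians of triangles in the comparison spaces -/

/-- The surface whose time separation is `T` contains points `a`, `b`, `c` and a midpoint `m` of `bc`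
such that `ab`, `ac`, `bc` have lengths `p - q`, `p + q`, `2 s` and the median `am` has
length `μ`. The half sum `p` and the half difference `q` of the two sides at `a` are used because
the formulas for the median are symmetric in them, and the reverse triangle inequality for the
sides becomes `s ≤ q`. -/
def HasMedian (T : ℝ × ℝ → ℝ × ℝ → ℝ≥0∞) (p q s μ : ℝ) : Prop :=
  ∃ a b c m : ℝ × ℝ,
    T a b = ENNReal.ofReal (p - q) ∧ T b c = ENNReal.ofReal (2 * s) ∧
    T a c = ENNReal.ofReal (p + q) ∧ T b m = ENNReal.ofReal s ∧
    T m c = ENNReal.ofReal s ∧ T a m = ENNReal.ofReal μ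

theorem minkowskiTau_eq_ofReal {p q : ℝ × ℝ} {l : ℝ} (h : 0 < q.1 - p.1) (hl : 0 < l)
    (hsq : (q.1 - p.1) ^ 2 - (q.2 - p.2) ^ 2 = l ^ 2) :
    minkowskiTau p q = ENNReal.ofReal l := by
  have h1 : |q.2 - p.2| < q.1 - p.1 := abs_lt_of_sq_lt_sq (by nlinarith [sq_pos_of_pos hl]) h.le
  rw [minkowskiTau, if_pos h1, hsq, Real.sqrt_sq hl.le]

theorem hasMedian_minkowskiTau {p q s : ℝ} (hs : 0 < s) (hsq : s ≤ q) (hqp : q < p) :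
    HasMedian minkowskiTau p q s (Real.sqrt (p ^ 2 + q ^ 2 - s ^ 2)) := by
  have h0 : 0 ≤ (p ^ 2 - s ^ 2) * (q ^ 2 - s ^ 2) :=
    mul_nonneg (by nlinarith) (by nlinarith)
  have hss : s < p * q / s := by rw [lt_div_iff₀ hs]; nlinarith
  have hx : (Real.sqrt ((p ^ 2 - s ^ 2) * (q ^ 2 - s ^ 2)) / s) ^ 2
      = (p ^ 2 - s ^ 2) * (q ^ 2 - s ^ 2) / s ^ 2 := by
    rw [div_pow, Real.sq_sqrt h0]
  have hM : 0 < p ^ 2 + q ^ 2 - s ^ 2 := by nlinarith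
  -- `b` and `c` lie on the time axis, symmetric to the origin `m`, and the lengths of `ab` and `ac`
  -- determine `a`
  refine ⟨(-(p * q / s), Real.sqrt ((p ^ 2 - s ^ 2) * (q ^ 2 - s ^ 2)) / s), (-s, 0), (s, 0),
    (0, 0), ?_, ?_, ?_, ?_, ?_, ?_⟩ <;> apply minkowskiTau_eq_ofReal
  all_goals first
    | (simp only [zero_sub, neg_sq, hx, Real.sq_sqrt hM.le]; field_simp; ring1)
    | linarith
    | exact Real.sqrt_pos.2 hM

theorem deSitterTau_eq_ofReal {r l : ℝ} {p q : ℝ × ℝ} (hl : 0 < l) (h : p.1 < q.1)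
    (hx : |q.2 - p.2| < Real.pi) (hprod : deSitterProd p q = Real.cosh l) :
    deSitterTau r p q = ENNReal.ofReal (r * l) := by
  rw [deSitterTau, if_pos ⟨h, hx, by rw [hprod]; exact Real.one_lt_cosh.2 hl.ne'⟩, hprod,
    Real.arcosh_cosh hl.le]

theorem one_lt_cosh_mul_cosh_div_cosh {p q s : ℝ} (hs : 0 < s) (hsq : s ≤ q) (hqp : q < p) :
    1 < Real.cosh p * Real.cosh q / Real.cosh s := by
  have h1 : Real.cosh s ≤ Real.cosh q :=
    Real.cosh_le_cosh.2 (by rwa [abs_of_pos hs, abs_of_pos (hs.trans_le hsq)])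
  have h2 : 1 < Real.cosh p := Real.one_lt_cosh.2 (by linarith)
  rw [lt_div_iff₀ (Real.cosh_pos s)]
  nlinarith [Real.cosh_pos s]

/-- The median in de Sitter space of radius `r`, in terms of the side lengths divided by `r`. On
the quadric the midpoint of `bc` is `(B + C) / (2 cosh s)`, so its product with `A` is the sum of
`cosh (p - q)` and `cosh (p + q)` divided by `2 cosh s`. -/
theorem hasMedian_deSitterTau (r : ℝ) {p q s : ℝ} (hs : 0 < s) (hsq : s ≤ q) (hqp : q < p) :
    ∃ a b c m : ℝ × ℝ,
      deSitterTau r a b = ENNReal.ofReal (r * (p - q)) ∧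
      deSitterTau r b c = ENNReal.ofReal (r * (2 * s)) ∧
      deSitterTau r a c = ENNReal.ofReal (r * (p + q)) ∧
      deSitterTau r b m = ENNReal.ofReal (r * s) ∧
      deSitterTau r m c = ENNReal.ofReal (r * s) ∧
      deSitterTau r a m =
        ENNReal.ofReal (r * Real.arcosh (Real.cosh p * Real.cosh q / Real.cosh s)) := by
  have hq : 0 < q := hs.trans_le hsq
  have hp : 0 < p := hq.trans hqp
  have hS : 0 < Real.sinh s := Real.sinh_pos_iff.2 hs
  have hSq : Real.sinh s ≤ Real.sinh q := Real.sinh_le_sinh.2 hsq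
  have hSp : Real.sinh s < Real.sinh p := Real.sinh_lt_sinh.2 (hsq.trans_lt hqp)
  have hC : 0 < Real.cosh s := Real.cosh_pos s
  -- `b` and `c` lie on the geodesic `x = 0`, symmetric to the origin `m`; the lengths of `ab` and
  -- `ac` then require `cosh t cos x = P` and `sinh t = -Q` for `a = (t, x)`
  set P := Real.cosh p * Real.cosh q / Real.cosh s with hP
  set Q := Real.sinh p * Real.sinh q / Real.sinh s with hQ
  have hP1 : 1 < P := one_lt_cosh_mul_cosh_div_cosh hs hsq hqp
  have hQs : Real.sinh s < Q := by rw [hQ, lt_div_iff₀ hS]; nlinarith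
  have hPQ : P ^ 2 ≤ 1 + Q ^ 2 := by
    -- after clearing denominators this is `0 ≤ (sinh² p - sinh² s) (sinh² q - sinh² s)`
    have hA : 0 ≤ (Real.sinh p ^ 2 - Real.sinh s ^ 2) * (Real.sinh q ^ 2 - Real.sinh s ^ 2) :=
      mul_nonneg (by nlinarith) (by nlinarith)
    have hSS : 0 < Real.sinh s ^ 2 := by positivity
    rw [hP, hQ, div_pow, div_pow, mul_pow, mul_pow, Real.cosh_sq p, Real.cosh_sq q, Real.cosh_sq s,
      one_add_div hSS.ne', div_le_div_iff₀ (by positivity) hSS]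
    nlinarith
  have hN : 0 < Real.sqrt (1 + Q ^ 2) := Real.sqrt_pos.2 (by positivity)
  have hPN : P / Real.sqrt (1 + Q ^ 2) ≤ 1 := by
    rw [div_le_one hN]; exact Real.le_sqrt_of_sq_le hPQ
  have hPN0 : 0 < P / Real.sqrt (1 + Q ^ 2) := by positivity
  have hcos : Real.cos (Real.arccos (P / Real.sqrt (1 + Q ^ 2))) = P / Real.sqrt (1 + Q ^ 2) :=
    Real.cos_arccos (by linarith) hPN
  have hx : |Real.arccos (P / Real.sqrt (1 + Q ^ 2))| < Real.pi := by
    rw [abs_of_nonneg (Real.arccos_nonneg _)]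
    exact Real.arccos_lt_pi.2 (by linarith)
  have ht : s < Real.arsinh Q := by
    rw [← Real.sinh_lt_sinh, Real.sinh_arsinh]; exact hQs
  have hcs : Real.sqrt (1 + Q ^ 2) * (P / Real.sqrt (1 + Q ^ 2)) = P := by field_simp
  have hcs' : ∀ y, Real.sqrt (1 + Q ^ 2) * y * (P / Real.sqrt (1 + Q ^ 2)) = P * y := by
    intro y; field_simp
  have hPC : P * Real.cosh s = Real.cosh p * Real.cosh q := by rw [hP]; field_simp
  have hQS : Q * Real.sinh s = Real.sinh p * Real.sinh q := by rw [hQ]; field_simp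
  have hl : 0 < Real.arcosh P := Real.arcosh_pos hP1
  refine ⟨(-Real.arsinh Q, Real.arccos (P / Real.sqrt (1 + Q ^ 2))), (-s, 0), (s, 0), (0, 0),
    ?_, ?_, ?_, ?_, ?_, ?_⟩ <;> apply deSitterTau_eq_ofReal
  all_goals first
    | exact hl
    | linarith
    | (simpa using hx)
    | (simpa using Real.pi_pos)
    | skip
  all_goals simp only [deSitterProd, zero_sub, sub_zero, Real.cos_neg, hcos, Real.cosh_neg,
    Real.sinh_neg, Real.cosh_arsinh, Real.sinh_arsinh, Real.cosh_zero, Real.sinh_zero,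
    Real.cos_zero, sub_self, hcs', hcs, mul_zero, mul_one, Real.cosh_arcosh hP1.le]
  all_goals first
    | (rw [Real.cosh_sub]; linarith)
    | (rw [Real.cosh_add]; linarith)
    | (rw [Real.cosh_two_mul]; ring1)
    | ring1

theorem antiDeSitterTau_eq_ofReal {r l : ℝ} {p q : ℝ × ℝ} (hl : 0 < l) (hl' : l ≤ Real.pi)
    (h : p.1 < q.1) (h' : q.1 - p.1 ≤ Real.pi) (hprod : antiDeSitterProd p q = Real.cos l) :
    antiDeSitterTau r p q = ENNReal.ofReal (r * l) := by
  have h1 : Real.cos l < 1 := by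
    rw [← Real.cos_zero]; exact Real.cos_lt_cos_of_nonneg_of_le_pi le_rfl hl' hl
  rw [antiDeSitterTau, if_neg, if_pos ⟨h', by rw [hprod]; exact Real.neg_one_le_cos l⟩, hprod,
    Real.arccos_cos hl.le hl']
  rw [hprod]
  rintro (h2 | ⟨-, h2⟩) <;> linarith

/-- The median in anti-de Sitter space of radius `r`, in terms of the side lengths divided by
`r`. The formula is the one for de Sitter space with `cos` for `cosh`; the size bound keeps the
triangle in the range where the cosine determines the time separation. -/
theorem hasMedian_antiDeSitterTau (r : ℝ) {p q s : ℝ} (hs : 0 < s) (hsq : s ≤ q) (hqp : q < p)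
    (hpq : p + q < Real.pi / 2) :
    ∃ a b c m : ℝ × ℝ,
      antiDeSitterTau r a b = ENNReal.ofReal (r * (p - q)) ∧
      antiDeSitterTau r b c = ENNReal.ofReal (r * (2 * s)) ∧
      antiDeSitterTau r a c = ENNReal.ofReal (r * (p + q)) ∧
      antiDeSitterTau r b m = ENNReal.ofReal (r * s) ∧
      antiDeSitterTau r m c = ENNReal.ofReal (r * s) ∧
      antiDeSitterTau r a m =
        ENNReal.ofReal (r * Real.arccos (Real.cos p * Real.cos q / Real.cos s)) := by
  have hq : 0 < q := hs.trans_le hsq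
  have hp : 0 < p := hq.trans hqp
  have hpi := Real.pi_pos
  have hS : 0 < Real.sin s := Real.sin_pos_of_pos_of_lt_pi hs (by linarith)
  have hCs : 0 < Real.cos s := Real.cos_pos_of_mem_Ioo ⟨by linarith, by linarith⟩
  have hCq : 0 < Real.cos q := Real.cos_pos_of_mem_Ioo ⟨by linarith, by linarith⟩
  have hCp : 0 < Real.cos p := Real.cos_pos_of_mem_Ioo ⟨by linarith, by linarith⟩
  have hSq : Real.sin s ≤ Real.sin q :=
    Real.sin_le_sin_of_le_of_le_pi_div_two (by linarith) (by linarith) hsq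
  have hSp : Real.sin s < Real.sin p :=
    Real.sin_lt_sin_of_lt_of_le_pi_div_two (by linarith) (by linarith) (hsq.trans_lt hqp)
  have hCsq : Real.cos q ≤ Real.cos s :=
    Real.cos_le_cos_of_nonneg_of_le_pi hs.le (by linarith) hsq
  have hCsp : Real.cos p < Real.cos s :=
    Real.cos_lt_cos_of_nonneg_of_le_pi hs.le (by linarith) (hsq.trans_lt hqp)
  have hCs1 : Real.cos s ≤ 1 := Real.cos_le_one s
  -- `b` and `c` lie on the geodesic `x = 0`, symmetric to the origin `m`; the lengths of `ab` and
  -- `ac` then require `cosh x cos t = P` and `cosh x sin t = -Q` for `a = (t, x)`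
  set P := Real.cos p * Real.cos q / Real.cos s with hP
  set Q := Real.sin p * Real.sin q / Real.sin s with hQ
  have hP0 : 0 < P := by positivity
  have hPs : P < Real.cos s := by rw [hP, div_lt_iff₀ hCs]; nlinarith
  have hQ0 : 0 < Q := hS.trans (by rw [hQ, lt_div_iff₀ hS]; nlinarith)
  have hPQ : 1 ≤ P ^ 2 + Q ^ 2 := by
    -- after clearing denominators this is `0 ≤ (sin² p - sin² s) (sin² q - sin² s)`
    have hA : 0 ≤ (Real.sin p ^ 2 - Real.sin s ^ 2) * (Real.sin q ^ 2 - Real.sin s ^ 2) :=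
      mul_nonneg (by nlinarith) (by nlinarith)
    have hSS : 0 < Real.sin s ^ 2 := by positivity
    have hCC : 0 < Real.cos s ^ 2 := by positivity
    rw [hP, hQ, div_pow, div_pow, mul_pow, mul_pow, div_add_div _ _ hCC.ne' hSS.ne',
      le_div_iff₀ (by positivity), Real.cos_sq' p, Real.cos_sq' q, Real.cos_sq' s]
    nlinarith
  set N := Real.sqrt (P ^ 2 + Q ^ 2) with hN
  have hN1 : 1 ≤ N := Real.one_le_sqrt.2 hPQ
  have hN0 : 0 < N := by linarith
  have hNsq : N ^ 2 = P ^ 2 + Q ^ 2 := Real.sq_sqrt (by positivity)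
  have hPN0 : 0 < P / N := by positivity
  have hPNs : P / N < Real.cos s := by rw [div_lt_iff₀ hN0]; nlinarith
  have hcos : Real.cos (Real.arccos (P / N)) = P / N :=
    Real.cos_arccos (by linarith) (by linarith)
  have hsin : Real.sin (Real.arccos (P / N)) = Q / N := by
    rw [Real.sin_arccos, Real.sqrt_eq_iff_mul_self_eq_of_pos (by positivity)]
    field_simp
    linarith
  have ht : s < Real.arccos (P / N) := by
    rw [← Real.arccos_cos hs.le (show s ≤ Real.pi by linarith)]
    exact Real.arccos_lt_arccos (by linarith) hPNs hCs1
  have ht' : Real.arccos (P / N) < Real.pi / 2 := Real.arccos_lt_pi_div_two.2 hPN0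
  have hPC : P * Real.cos s = Real.cos p * Real.cos q := by rw [hP]; field_simp
  have hQS : Q * Real.sin s = Real.sin p * Real.sin q := by rw [hQ]; field_simp
  have hl : 0 < Real.arccos P := Real.arccos_pos.2 (by linarith)
  have hl' : Real.arccos P < Real.pi / 2 := Real.arccos_lt_pi_div_two.2 hP0
  have hNP : N * (P / N) = P := by field_simp
  have hNQ : N * (Q / N) = Q := by field_simp
  refine ⟨(-Real.arccos (P / N), Real.arcosh N), (-s, 0), (s, 0), (0, 0),
    ?_, ?_, ?_, ?_, ?_, ?_⟩ <;> apply antiDeSitterTau_eq_ofReal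
  all_goals first
    | exact hl
    | linarith
    | skip
  all_goals simp only [antiDeSitterProd, sub_zero, sub_neg_eq_add, hcos,
    Real.cosh_arcosh hN1, Real.cosh_zero, Real.sinh_zero, Real.cos_zero, Real.sin_zero, zero_mul,
    mul_zero, mul_one, one_mul,
    Real.cos_arccos (show -1 ≤ P by linarith) (show P ≤ 1 by linarith), Real.cos_add,
    Real.cos_neg, Real.sin_neg, hsin, mul_sub, hNP, ← two_mul,
    Real.cos_sub]
  · linear_combination hPC + hQS + Real.cos s * hNP + Real.sin s * hNQ
  · linear_combination hPC - hQS + Real.cos s * hNP - Real.sin s * hNQ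

theorem modelTau_of_pos {K : ℝ} (hK : 0 < K) : modelTau K = deSitterTau (1 / Real.sqrt K) := by
  funext p q; rw [modelTau, if_pos hK]

theorem modelTau_of_neg {K : ℝ} (hK : K < 0) :
    modelTau K = antiDeSitterTau (1 / Real.sqrt (-K)) := by
  funext p q; rw [modelTau, if_neg hK.not_gt, if_pos hK]

theorem modelTau_zero : modelTau 0 = minkowskiTau := by
  funext p q; rw [modelTau, if_neg (lt_irrefl _), if_neg (lt_irrefl _)]

theorem hasMedian_modelTau_of_pos {K : ℝ} (hK : 0 < K) {p q s : ℝ} (hs : 0 < s) (hsq : s ≤ q)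
    (hqp : q < p) :
    HasMedian (modelTau K) p q s (1 / √K *
      Real.arcosh (Real.cosh (√K * p) * Real.cosh (√K * q) / Real.cosh (√K * s))) := by
  have hk : 0 < √K := Real.sqrt_pos.2 hK
  obtain ⟨a, b, c, m, h1, h2, h3, h4, h5, h6⟩ := hasMedian_deSitterTau (1 / √K)
    (mul_pos hk hs) (mul_le_mul_of_nonneg_left hsq hk.le) (mul_lt_mul_of_pos_left hqp hk)
  rw [modelTau_of_pos hK]
  refine ⟨a, b, c, m, h1.trans ?_, h2.trans ?_, h3.trans ?_, h4.trans ?_, h5.trans ?_, h6⟩ <;>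
    (congr 1; field_simp)

theorem hasMedian_modelTau_of_neg {K : ℝ} (hK : K < 0) {p q s : ℝ} (hs : 0 < s) (hsq : s ≤ q)
    (hqp : q < p) (hpq : √(-K) * (p + q) < Real.pi / 2) :
    HasMedian (modelTau K) p q s (1 / √(-K) *
      Real.arccos (Real.cos (√(-K) * p) * Real.cos (√(-K) * q) / Real.cos (√(-K) * s))) := by
  have hk : 0 < √(-K) := Real.sqrt_pos.2 (neg_pos.2 hK)
  obtain ⟨a, b, c, m, h1, h2, h3, h4, h5, h6⟩ := hasMedian_antiDeSitterTau (1 / √(-K))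
    (mul_pos hk hs) (mul_le_mul_of_nonneg_left hsq hk.le) (mul_lt_mul_of_pos_left hqp hk)
    (by rwa [← mul_add])
  rw [modelTau_of_neg hK]
  refine ⟨a, b, c, m, h1.trans ?_, h2.trans ?_, h3.trans ?_, h4.trans ?_, h5.trans ?_, h6⟩ <;>
    (congr 1; field_simp)

/-! ### Medians of small triangles -/

theorem tendsto_sinh_mul_div (a : ℝ) :
    Tendsto (fun ε : ℝ => Real.sinh (ε * a) / ε) (𝓝[>] 0) (𝓝 a) := by
  have h : HasDerivAt (fun ε : ℝ => Real.sinh (ε * a)) a 0 := by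
    simpa using ((hasDerivAt_id (0 : ℝ)).mul_const a).sinh
  simpa [div_eq_inv_mul] using (hasDerivAt_iff_tendsto_slope_zero.1 h).mono_left
    (nhdsGT_le_nhdsNE 0)

theorem tendsto_sin_mul_div (a : ℝ) :
    Tendsto (fun ε : ℝ => Real.sin (ε * a) / ε) (𝓝[>] 0) (𝓝 a) := by
  have h : HasDerivAt (fun ε : ℝ => Real.sin (ε * a)) a 0 := by
    simpa using ((hasDerivAt_id (0 : ℝ)).mul_const a).sin
  simpa [div_eq_inv_mul] using (hasDerivAt_iff_tendsto_slope_zero.1 h).mono_left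
    (nhdsGT_le_nhdsNE 0)

/-- `cosh (ε a) cosh (ε b) = 1 + (a² + b²) ε² / 2 + o(ε²)`. -/
theorem tendsto_cosh_mul_cosh (a b : ℝ) :
    Tendsto (fun ε : ℝ => (Real.cosh (ε * a) * Real.cosh (ε * b) - 1) / ε ^ 2) (𝓝[>] 0)
      (𝓝 ((a ^ 2 + b ^ 2) / 2)) := by
  have h := ((tendsto_sinh_mul_div ((a + b) / 2)).pow 2).add
    ((tendsto_sinh_mul_div ((a - b) / 2)).pow 2)
  convert h using 2 with ε
  · rw [div_pow, div_pow, ← add_div]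
    congr 1
    rw [show ε * a = ε * ((a + b) / 2) + ε * ((a - b) / 2) by ring,
      show ε * b = ε * ((a + b) / 2) - ε * ((a - b) / 2) by ring, Real.cosh_add, Real.cosh_sub]
    linear_combination
      Real.cosh (ε * ((a - b) / 2)) ^ 2 * Real.cosh_sq (ε * ((a + b) / 2))
      + (1 + Real.sinh (ε * ((a + b) / 2)) ^ 2) * Real.cosh_sq (ε * ((a - b) / 2))
  · ring

/-- `cos (ε a) cos (ε b) = 1 - (a² + b²) ε² / 2 + o(ε²)`. -/
theorem tendsto_cos_mul_cos (a b : ℝ) :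
    Tendsto (fun ε : ℝ => (1 - Real.cos (ε * a) * Real.cos (ε * b)) / ε ^ 2) (𝓝[>] 0)
      (𝓝 ((a ^ 2 + b ^ 2) / 2)) := by
  have h := ((tendsto_sin_mul_div ((a + b) / 2)).pow 2).add
    ((tendsto_sin_mul_div ((a - b) / 2)).pow 2)
  convert h using 2 with ε
  · rw [div_pow, div_pow, ← add_div]
    congr 1
    rw [show ε * a = ε * ((a + b) / 2) + ε * ((a - b) / 2) by ring,
      show ε * b = ε * ((a + b) / 2) - ε * ((a - b) / 2) by ring, Real.cos_add, Real.cos_sub]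
    linear_combination
      -Real.cos (ε * ((a - b) / 2)) ^ 2 * Real.cos_sq' (ε * ((a + b) / 2))
      - (1 - Real.sin (ε * ((a + b) / 2)) ^ 2) * Real.cos_sq' (ε * ((a - b) / 2))
  · ring

theorem eventually_cosh_mul_cosh_lt {a b c d : ℝ} (h : a ^ 2 + b ^ 2 < c ^ 2 + d ^ 2) :
    ∀ᶠ ε : ℝ in 𝓝[>] 0,
      Real.cosh (ε * a) * Real.cosh (ε * b) < Real.cosh (ε * c) * Real.cosh (ε * d) := by
  filter_upwards [(tendsto_cosh_mul_cosh a b).eventually_lt (tendsto_cosh_mul_cosh c d)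
    (by linarith), self_mem_nhdsWithin] with ε h1 (hε : 0 < ε)
  have := (div_lt_div_iff_of_pos_right (by positivity)).1 h1
  linarith

theorem eventually_cos_mul_cos_lt {a b c d : ℝ} (h : a ^ 2 + b ^ 2 < c ^ 2 + d ^ 2) :
    ∀ᶠ ε : ℝ in 𝓝[>] 0,
      Real.cos (ε * c) * Real.cos (ε * d) < Real.cos (ε * a) * Real.cos (ε * b) := by
  filter_upwards [(tendsto_cos_mul_cos a b).eventually_lt (tendsto_cos_mul_cos c d)
    (by linarith), self_mem_nhdsWithin] with ε h1 (hε : 0 < ε)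
  have := (div_lt_div_iff_of_pos_right (by positivity)).1 h1
  linarith

theorem eventually_mul_lt (l : ℝ) {δ : ℝ} (hδ : 0 < δ) : ∀ᶠ ε : ℝ in 𝓝[>] 0, ε * l < δ := by
  have h : Tendsto (fun ε : ℝ => ε * l) (𝓝[>] 0) (𝓝 (0 * l)) :=
    (tendsto_id.mono_left nhdsWithin_le_nhds).mul_const l
  rw [zero_mul] at h
  exact h.eventually_lt_const hδ

theorem eventually_cos_mul_pos {a : ℝ} (ha : 0 < a) :
    ∀ᶠ ε : ℝ in 𝓝[>] 0, 0 < Real.cos (ε * a) := by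
  filter_upwards [eventually_mul_lt a (half_pos Real.pi_pos), self_mem_nhdsWithin]
    with ε h1 (hε : 0 < ε)
  exact Real.cos_pos_of_mem_Ioo ⟨by linarith [mul_pos hε ha, Real.pi_pos], h1⟩

/-- To first order the median of a small triangle is the Minkowski median
`√(p² + q² - s²)`: it is eventually larger than every smaller multiple of `ε`. -/
theorem eventually_lt_median (K : ℝ) {p q s l : ℝ} (hs : 0 < s) (hsq : s ≤ q) (hqp : q < p)
    (hl : 0 < l) (h : s ^ 2 + l ^ 2 < p ^ 2 + q ^ 2) :
    ∀ᶠ ε : ℝ in 𝓝[>] 0, ∃ μ, HasMedian (modelTau K) (ε * p) (ε * q) (ε * s) μ ∧ ε * l < μ := by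
  have hpos : ∀ᶠ ε : ℝ in 𝓝[>] 0, 0 < ε := self_mem_nhdsWithin
  rcases lt_trichotomy K 0 with hK | rfl | hK
  · have hk : 0 < √(-K) := Real.sqrt_pos.2 (neg_pos.2 hK)
    have h' : (√(-K) * s) ^ 2 + (√(-K) * l) ^ 2 < (√(-K) * p) ^ 2 + (√(-K) * q) ^ 2 := by
      nlinarith [sq_pos_of_pos hk]
    have hq : 0 < q := hs.trans_le hsq
    have hp : 0 < p := hq.trans hqp
    filter_upwards [eventually_cos_mul_cos_lt h', hpos,
      eventually_mul_lt (√(-K) * (p + q)) (half_pos Real.pi_pos),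
      eventually_mul_lt (√(-K) * l) Real.pi_pos,
      eventually_cos_mul_pos (mul_pos hk hs), eventually_cos_mul_pos (mul_pos hk hp),
      eventually_cos_mul_pos (mul_pos hk hq)] with ε h1 hε h2 h3 hCs hCp hCq
    refine ⟨_, hasMedian_modelTau_of_neg hK (mul_pos hε hs) (by gcongr) (by gcongr)
      (by rw [← mul_add, mul_left_comm]; exact h2), ?_⟩
    simp only [mul_left_comm √(-K) ε]
    have hl0 : 0 < ε * (√(-K) * l) := by positivity
    rw [one_div, ← div_eq_inv_mul, lt_div_iff₀ hk, show ε * l * √(-K) = ε * (√(-K) * l) by ring,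
      ← Real.arccos_cos hl0.le h3.le]
    refine Real.arccos_lt_arccos (by linarith [div_pos (mul_pos hCp hCq) hCs]) ?_
      (Real.cos_le_one _)
    rw [div_lt_iff₀ hCs]
    linarith
  · filter_upwards [hpos] with ε hε
    rw [modelTau_zero]
    refine ⟨_, hasMedian_minkowskiTau (mul_pos hε hs) (by gcongr) (by gcongr), ?_⟩
    apply Real.lt_sqrt_of_sq_lt
    nlinarith [sq_pos_of_pos hε]
  · have hk : 0 < √K := Real.sqrt_pos.2 hK
    have h' : (√K * s) ^ 2 + (√K * l) ^ 2 < (√K * p) ^ 2 + (√K * q) ^ 2 := by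
      nlinarith [sq_pos_of_pos hk]
    filter_upwards [eventually_cosh_mul_cosh_lt h', hpos] with ε h1 hε
    refine ⟨_, hasMedian_modelTau_of_pos hK (mul_pos hε hs) (by gcongr) (by gcongr), ?_⟩
    simp only [mul_left_comm √K ε]
    have hl0 : 0 < ε * (√K * l) := by positivity
    rw [one_div, ← div_eq_inv_mul, lt_div_iff₀ hk, show ε * l * √K = ε * (√K * l) by ring,
      ← Real.arcosh_cosh hl0.le, Real.arcosh_lt_arcosh (Real.cosh_pos _) (by positivity),
      lt_div_iff₀ (Real.cosh_pos _)]
    linarith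
/-- To first order the median of a small triangle is the Minkowski median
`√(p² + q² - s²)`: it is eventually smaller than every larger multiple of `ε`. -/
theorem eventually_median_lt (K : ℝ) {p q s l : ℝ} (hs : 0 < s) (hsq : s ≤ q) (hqp : q < p)
    (hl : 0 < l) (h : p ^ 2 + q ^ 2 < s ^ 2 + l ^ 2) :
    ∀ᶠ ε : ℝ in 𝓝[>] 0, ∃ μ, HasMedian (modelTau K) (ε * p) (ε * q) (ε * s) μ ∧ μ < ε * l := by
  have hpos : ∀ᶠ ε : ℝ in 𝓝[>] 0, 0 < ε := self_mem_nhdsWithin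
  rcases lt_trichotomy K 0 with hK | rfl | hK
  · have hk : 0 < √(-K) := Real.sqrt_pos.2 (neg_pos.2 hK)
    have h' : (√(-K) * p) ^ 2 + (√(-K) * q) ^ 2 < (√(-K) * s) ^ 2 + (√(-K) * l) ^ 2 := by
      nlinarith [sq_pos_of_pos hk]
    have hq : 0 < q := hs.trans_le hsq
    have hp : 0 < p := hq.trans hqp
    filter_upwards [eventually_cos_mul_cos_lt h', hpos,
      eventually_mul_lt (√(-K) * (p + q)) (half_pos Real.pi_pos),
      eventually_mul_lt (√(-K) * l) Real.pi_pos,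
      eventually_cos_mul_pos (mul_pos hk hs), eventually_cos_mul_pos (mul_pos hk hp),
      eventually_cos_mul_pos (mul_pos hk hq)] with ε h1 hε h2 h3 hCs hCp hCq
    refine ⟨_, hasMedian_modelTau_of_neg hK (mul_pos hε hs) (by gcongr) (by gcongr)
      (by rw [← mul_add, mul_left_comm]; exact h2), ?_⟩
    simp only [mul_left_comm √(-K) ε]
    have hl0 : 0 < ε * (√(-K) * l) := by positivity
    rw [one_div, ← div_eq_inv_mul, div_lt_iff₀ hk, show ε * l * √(-K) = ε * (√(-K) * l) by ring,
      ← Real.arccos_cos hl0.le h3.le]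
    have hsq' : ε * (√(-K) * s) ≤ ε * (√(-K) * q) := by gcongr
    have hq' : ε * (√(-K) * q) ≤ ε * (√(-K) * (p + q)) := by gcongr; linarith
    refine Real.arccos_lt_arccos (Real.neg_one_le_cos _) ?_ ?_
    · rw [lt_div_iff₀ hCs]
      linarith
    · rw [div_le_one hCs]
      exact (mul_le_of_le_one_left hCq.le (Real.cos_le_one _)).trans
        (Real.cos_le_cos_of_nonneg_of_le_pi (by positivity) (by linarith [Real.pi_pos]) hsq')
  · filter_upwards [hpos] with ε hε
    rw [modelTau_zero]
    refine ⟨_, hasMedian_minkowskiTau (mul_pos hε hs) (by gcongr) (by gcongr), ?_⟩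
    rw [Real.sqrt_lt' (by positivity)]
    nlinarith [sq_pos_of_pos hε]
  · have hk : 0 < √K := Real.sqrt_pos.2 hK
    have h' : (√K * p) ^ 2 + (√K * q) ^ 2 < (√K * s) ^ 2 + (√K * l) ^ 2 := by
      nlinarith [sq_pos_of_pos hk]
    filter_upwards [eventually_cosh_mul_cosh_lt h', hpos] with ε h1 hε
    refine ⟨_, hasMedian_modelTau_of_pos hK (mul_pos hε hs) (by gcongr) (by gcongr), ?_⟩
    simp only [mul_left_comm √K ε]
    have hl0 : 0 < ε * (√K * l) := by positivity
    rw [one_div, ← div_eq_inv_mul, div_lt_iff₀ hk, show ε * l * √K = ε * (√K * l) by ring,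
      ← Real.arcosh_cosh hl0.le, Real.arcosh_lt_arcosh (by positivity) (Real.cosh_pos _),
      div_lt_iff₀ (Real.cosh_pos _)]
    linarith

/-- Every size is within the timelike diameter after rescaling by a small factor. -/
theorem eventually_lt_modelDiam (K l : ℝ) :
    ∀ᶠ ε : ℝ in 𝓝[>] 0, ENNReal.ofReal (ε * l) < modelDiam K := by
  unfold modelDiam
  split_ifs with hK
  · have hD : 0 < Real.pi / √(-K) := div_pos Real.pi_pos (Real.sqrt_pos.2 (neg_pos.2 hK))
    filter_upwards [eventually_mul_lt l hD] with ε hε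
    exact (ENNReal.ofReal_lt_ofReal_iff hD).2 hε
  · exact Eventually.of_forall fun _ => ENNReal.ofReal_lt_top

/-! ### Translation invariant, positively homogeneous time separations -/

namespace LorentzianPreLengthSpace

variable {X : Type*} [AddCommGroup X] [MetricSpace X]

section

variable {S : LorentzianPreLengthSpace X}

theorem τ_add_right_eq (htrans : ∀ x y z : X, S.τ (x + z) (y + z) = S.τ x y) (p v : X) :
    S.τ p (p + v) = S.τ 0 v := by
  simpa [add_comm] using htrans 0 v p

theorem τ_eq_τ_sub (htrans : ∀ x y z : X, S.τ (x + z) (y + z) = S.τ x y) (p q : X) :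
    S.τ p q = S.τ 0 (q - p) := by
  rw [← τ_add_right_eq htrans p, add_sub_cancel]

theorem τ_add_le (htrans : ∀ x y z : X, S.τ (x + z) (y + z) = S.τ x y) {v w : X}
    (hv : S.ll 0 v) (hw : S.ll 0 w) : S.τ 0 v + S.τ 0 w ≤ S.τ 0 (v + w) := by
  have hw' : S.ll v (v + w) := by
    rwa [← S.τ_pos_iff, τ_add_right_eq htrans, S.τ_pos_iff]
  calc S.τ 0 v + S.τ 0 w = S.τ 0 v + S.τ v (v + w) := by rw [τ_add_right_eq htrans]
    _ ≤ _ := S.reverse_triangle _ _ _ (S.cle_of_ll _ _ hv) (S.cle_of_ll _ _ hw')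

variable [Module ℝ X]

/-- Affine segments with timelike direction are distance realizers. -/
theorem isRealizerIn_line (hline : ∀ p v : X, LocallyLipschitz (fun t : ℝ => p + t • v))
    (htrans : ∀ x y z : X, S.τ (x + z) (y + z) = S.τ x y)
    (hhom : ∀ (c : ℝ) (x : X), 0 < c → S.τ 0 (c • x) = ENNReal.ofReal c * S.τ 0 x)
    {U : Set X} {p v : X} (hv : S.ll 0 v) (hfin : S.τ 0 v ≠ ⊤)
    (hU : ∀ t ∈ Set.Icc (0 : ℝ) 1, p + t • v ∈ U) :
    S.IsRealizerIn U p (p + v) (fun t => p + t • v) := by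
  have hτ : ∀ s t : ℝ, s < t →
      S.τ (p + s • v) (p + t • v) = ENNReal.ofReal (t - s) * S.τ 0 v := by
    intro s t hst
    rw [← hhom _ _ (sub_pos.2 hst), τ_eq_τ_sub htrans, add_sub_add_left_eq_sub, sub_smul]
  have hv0 : v ≠ 0 := by
    -- homogeneity leaves only the values `0` and `∞` for `τ(0, 0)`
    rintro rfl
    have h2 := hhom 2 0 two_pos
    rw [smul_zero] at h2
    have h3 : 0 < (S.τ 0 (0 : X)).toReal := ENNReal.toReal_pos ((S.τ_pos_iff _ _).2 hv).ne' hfin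
    have h4 := congrArg ENNReal.toReal h2
    rw [ENNReal.toReal_mul, ENNReal.toReal_ofReal two_pos.le] at h4
    linarith
  refine ⟨⟨?_, ⟨0, by simp, 1, by simp, by simpa using hv0⟩, ?_⟩, by simp, by simp, hU, ?_⟩
  · exact (hline p v).locallyLipschitzOn.exists_lipschitzOnWith_of_compact isCompact_Icc
  · intro s _ t _ hst
    refine S.cle_of_ll _ _ ((S.τ_pos_iff _ _).1 ?_)
    rw [hτ s t hst]
    exact ENNReal.mul_pos (ENNReal.ofReal_pos.2 (sub_pos.2 hst)).ne' ((S.τ_pos_iff _ _).2 hv).ne'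
  · rw [τ_add_right_eq htrans]
    have hsum : ∀ (n : ℕ) (t : ℕ → ℝ), (∀ i < n, t i < t (i + 1)) →
        ∑ i ∈ Finset.range n, S.τ (p + t i • v) (p + t (i + 1) • v)
          = ENNReal.ofReal (t n - t 0) * S.τ 0 v := by
      intro n t ht
      rw [← Finset.sum_range_sub t n, ENNReal.ofReal_sum_of_nonneg, Finset.sum_mul]
      · exact Finset.sum_congr rfl fun i hi => hτ _ _ (ht i (Finset.mem_range.1 hi))
      · exact fun i hi => (sub_pos.2 (ht i (Finset.mem_range.1 hi))).le
    apply le_antisymm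
    · refine iInf_le_of_le 1 <| iInf_le_of_le (fun i : ℕ => (i : ℝ)) <|
        iInf_le_of_le Nat.cast_zero <| iInf_le_of_le Nat.cast_one <|
        iInf_le_of_le (by simp) ?_
      rw [hsum 1 _ (by simp)]
      simp
    · refine le_iInf fun n => le_iInf fun t => le_iInf fun h0 => le_iInf fun h1 =>
        le_iInf fun ht => ?_
      rw [hsum n t ht, h0, h1]
      simp

/-- The triangle with vertices `u`, `u + ε (x - y)`, `u + ε (x + y)` is contained in a given
neighbourhood of `u` for small `ε`; its median at `u` ends at `u + ε x`. A comparison median of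
length `μ` therefore makes `(u, u + ε x)` a comparison pair with model time separation `μ`. -/
theorem exists_isComparisonPair_of_hasMedian
    (hline : ∀ p v : X, LocallyLipschitz (fun t : ℝ => p + t • v))
    (htrans : ∀ x y z : X, S.τ (x + z) (y + z) = S.τ x y)
    (hhom : ∀ (c : ℝ) (x : X), 0 < c → S.τ 0 (c • x) = ENNReal.ofReal c * S.τ 0 x)
    {K ε μ p q s : ℝ} {U : Set X} {u x y : X} (hε : 0 < ε) (hs : 0 < s) (hqp : q < p)
    (hpq : 0 < p + q)
    (hy : S.τ 0 y = ENNReal.ofReal s) (hsub : S.τ 0 (x - y) = ENNReal.ofReal (p - q))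
    (hadd : S.τ 0 (x + y) = ENNReal.ofReal (p + q))
    (hU : ∀ α β : ℝ, |α| ≤ ε → |β| ≤ ε → u + α • x + β • y ∈ U)
    (hdiam : ENNReal.ofReal (ε * (p + q)) < modelDiam K)
    (hmed : HasMedian (modelTau K) (ε * p) (ε * q) (ε * s) μ) :
    ∃ v' m', S.IsComparisonPair K U u (u + ε • x) v' m' ∧
      modelTau K v' m' = ENNReal.ofReal μ := by
  obtain ⟨a', b', c', m', hab, hbc, hac, hbm, hmc, ham⟩ := hmed
  have hscale : ∀ {z : X} {l c : ℝ}, 0 < c → S.τ 0 z = ENNReal.ofReal l →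
      S.τ 0 (c • z) = ENNReal.ofReal (c * l) := by
    intro z l c hc hz
    rw [hhom c z hc, hz, ENNReal.ofReal_mul hc.le]
  have hll : ∀ {z : X} {l : ℝ}, 0 < l → S.τ 0 z = ENNReal.ofReal l → S.ll 0 z := by
    intro z l hl hz
    rw [← S.τ_pos_iff, hz, ENNReal.ofReal_pos]
    exact hl
  have hAB : S.τ 0 (ε • (x - y)) = ENNReal.ofReal (ε * (p - q)) := hscale hε hsub
  have hAC : S.τ 0 (ε • (x + y)) = ENNReal.ofReal (ε * (p + q)) := hscale hε hadd
  have hBM : S.τ 0 (ε • y) = ENNReal.ofReal (ε * s) := hscale hε hy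
  have hBC : S.τ 0 ((2 * ε) • y) = ENNReal.ofReal (2 * (ε * s)) := by
    rw [hscale (by positivity) hy, mul_assoc]
  have hABl := hll (mul_pos hε (sub_pos.2 hqp)) hAB
  have hACl := hll (mul_pos hε hpq) hAC
  have hBCl := hll (by positivity) hBC
  have hb_c : u + ε • (x + y) = u + ε • (x - y) + (2 * ε) • y := by module
  have hb_m : u + ε • x = u + ε • (x - y) + ε • y := by module
  have hm_c : u + ε • (x + y) = u + ε • x + ε • y := by module
  have habs : ∀ t ∈ Set.Icc (0 : ℝ) 1, |t * ε| ≤ ε := by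
    intro t ht
    rw [abs_of_nonneg (mul_nonneg ht.1 hε.le)]
    nlinarith [ht.2]
  have rab : S.IsRealizerIn U u (u + ε • (x - y)) (fun t => u + t • ε • (x - y)) := by
    refine isRealizerIn_line hline htrans hhom hABl (by rw [hAB]; exact ENNReal.ofReal_ne_top) ?_
    intro t ht
    rw [show u + t • ε • (x - y) = u + (t * ε) • x + (-(t * ε)) • y by module]
    exact hU _ _ (habs t ht) (by rw [abs_neg]; exact habs t ht)
  have rac : S.IsRealizerIn U u (u + ε • (x + y)) (fun t => u + t • ε • (x + y)) := by
    refine isRealizerIn_line hline htrans hhom hACl (by rw [hAC]; exact ENNReal.ofReal_ne_top) ?_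
    intro t ht
    rw [show u + t • ε • (x + y) = u + (t * ε) • x + (t * ε) • y by module]
    exact hU _ _ (habs t ht) (habs t ht)
  have rbc : S.IsRealizerIn U (u + ε • (x - y)) (u + ε • (x + y))
      (fun t => u + ε • (x - y) + t • (2 * ε) • y) := by
    rw [hb_c]
    refine isRealizerIn_line hline htrans hhom hBCl (by rw [hBC]; exact ENNReal.ofReal_ne_top) ?_
    intro t ht
    rw [show u + ε • (x - y) + t • (2 * ε) • y = u + ε • x + ((2 * t - 1) * ε) • y by module]
    refine hU _ _ (abs_of_pos hε).le ?_
    rw [abs_mul, abs_of_pos hε]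
    exact mul_le_of_le_one_left hε.le (abs_le.2 ⟨by linarith [ht.1], by linarith [ht.2]⟩)
  have dab : S.τ u (u + ε • (x - y)) = ENNReal.ofReal (ε * (p - q)) := by
    rw [τ_add_right_eq htrans, hAB]
  have dac : S.τ u (u + ε • (x + y)) = ENNReal.ofReal (ε * (p + q)) := by
    rw [τ_add_right_eq htrans, hAC]
  have dbc : S.τ (u + ε • (x - y)) (u + ε • (x + y)) = ENNReal.ofReal (2 * (ε * s)) := by
    rw [hb_c, τ_add_right_eq htrans, hBC]
  have dbm : S.τ (u + ε • (x - y)) (u + ε • x) = ENNReal.ofReal (ε * s) := by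
    rw [hb_m, τ_add_right_eq htrans, hBM]
  have dmc : S.τ (u + ε • x) (u + ε • (x + y)) = ENNReal.ofReal (ε * s) := by
    rw [hm_c, τ_add_right_eq htrans, hBM]
  have hεs : 0 < ε * s := mul_pos hε hs
  refine ⟨a', m', ⟨u, u + ε • (x - y), u + ε • (x + y), _, _, _, a', b', c',
    ⟨?_, ?_, by rwa [dac], rab, rbc, rac⟩, ⟨?_, ?_, ?_⟩,
    Or.inl ⟨rfl, rfl, ⟨1 / 2, by norm_num, by module⟩, Or.inr (Or.inr ⟨?_, ?_, ?_⟩), ?_, ?_⟩⟩, ham⟩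
  · rw [← S.τ_pos_iff, dab]; exact ENNReal.ofReal_pos.2 (mul_pos hε (sub_pos.2 hqp))
  · rw [← S.τ_pos_iff, dbc]; exact ENNReal.ofReal_pos.2 (by positivity)
  · rw [hab, dab, mul_sub]
  · rw [hbc, dbc]
  · rw [hac, dac, mul_add]
  · rw [hbm]; exact ENNReal.ofReal_pos.2 hεs
  · rw [hmc]; exact ENNReal.ofReal_pos.2 hεs
  · rw [hbm, hmc, hbc, ← ENNReal.ofReal_add hεs.le hεs.le, two_mul]
  · rw [hbm, dbm]
  · rw [hmc, dmc]

/-- Where the parallelogram law fails, all four time separations are finite. By the reverse triangle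
inequality `τ(0, x) = ∞` gives `τ(0, x + y) = ∞`, so that the law holds in the form `∞ = ∞`; and
`τ(0, y)`, `τ(0, x - y)` are bounded by `τ(0, x)`, while `τ(0, x + y)` is bounded by
`τ(0, 2 x) = 2 τ(0, x)`. -/
theorem τ_ne_top_of_parallelogram_ne (htrans : ∀ x y z : X, S.τ (x + z) (y + z) = S.τ x y)
    (hhom : ∀ (c : ℝ) (x : X), 0 < c → S.τ 0 (c • x) = ENNReal.ofReal c * S.τ 0 x)
    {x y : X} (hx : S.ll 0 x) (hy : S.ll 0 y) (hadd : S.ll 0 (x + y)) (hsub : S.ll 0 (x - y))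
    (hne : 2 * S.τ 0 x ^ 2 + 2 * S.τ 0 y ^ 2 ≠ S.τ 0 (x + y) ^ 2 + S.τ 0 (x - y) ^ 2) :
    S.τ 0 x ≠ ⊤ ∧ S.τ 0 y ≠ ⊤ ∧ S.τ 0 (x + y) ≠ ⊤ ∧ S.τ 0 (x - y) ≠ ⊤ := by
  have h1 := τ_add_le htrans hx hy
  have h2 := τ_add_le htrans hsub hy
  rw [sub_add_cancel] at h2
  have h3 := τ_add_le htrans hadd hsub
  rw [show x + y + (x - y) = (2 : ℝ) • x by module, hhom 2 x two_pos] at h3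
  have hx' : S.τ 0 x ≠ ⊤ := by
    intro hxt
    rw [hxt, top_add, top_le_iff] at h1
    exact hne (by simp [hxt, h1])
  have h3' : ENNReal.ofReal 2 * S.τ 0 x ≠ ⊤ := ENNReal.mul_ne_top ENNReal.ofReal_ne_top hx'
  exact ⟨hx', ne_top_of_le_ne_top hx' (le_add_self.trans h2),
    ne_top_of_le_ne_top h3' (le_self_add.trans h3),
    ne_top_of_le_ne_top hx' (le_self_add.trans h2)⟩

end

variable [Module ℝ X] [IsTopologicalAddGroup X] [ContinuousSMul ℝ X]

/-- Small parallelograms at an interior point `u` of `U` stay in `U`. -/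
theorem eventually_parallelogram_mem {U : Set X} (hU : IsOpen U) {u : X} (hu : u ∈ U) (x y : X) :
    ∀ᶠ ε : ℝ in 𝓝[>] 0, ∀ α β : ℝ, |α| ≤ ε → |β| ≤ ε → u + α • x + β • y ∈ U := by
  have hc : Continuous (fun r : ℝ × ℝ => u + r.1 • x + r.2 • y) := by fun_prop
  obtain ⟨δ, hδ, hball⟩ := Metric.isOpen_iff.1 (hU.preimage hc) (0, 0) (by simpa using hu)
  filter_upwards [eventually_mul_lt 1 hδ] with ε hε α β hα hβ
  apply @hball (α, β)
  rw [Metric.mem_ball, Prod.dist_eq, max_lt_iff, Real.dist_eq, Real.dist_eq]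
  constructor <;> simp only [sub_zero] <;> linarith

variable {S : LorentzianPreLengthSpace X}

/-- If the parallelogram law fails in one direction, then some median in `U` is shorter than its
comparison median. -/
theorem exists_isComparisonPair_lt
    (hline : ∀ p v : X, LocallyLipschitz (fun t : ℝ => p + t • v))
    (htrans : ∀ x y z : X, S.τ (x + z) (y + z) = S.τ x y)
    (hhom : ∀ (c : ℝ) (x : X), 0 < c → S.τ 0 (c • x) = ENNReal.ofReal c * S.τ 0 x)
    (K : ℝ) {U : Set X} (hU : IsOpen U) {u : X} (hu : u ∈ U) {x y : X} {p q s l : ℝ}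
    (hs : 0 < s) (hsq : s ≤ q) (hqp : q < p) (hl : 0 < l) (hx : S.τ 0 x = ENNReal.ofReal l)
    (hy : S.τ 0 y = ENNReal.ofReal s) (hsub : S.τ 0 (x - y) = ENNReal.ofReal (p - q))
    (hadd : S.τ 0 (x + y) = ENNReal.ofReal (p + q))
    (h : s ^ 2 + l ^ 2 < p ^ 2 + q ^ 2) :
    ∃ v m v' m', S.IsComparisonPair K U v m v' m' ∧ S.τ v m < modelTau K v' m' := by
  obtain ⟨ε, ⟨μ, hmed, hμ⟩, hmem, hd, (hε : 0 < ε)⟩ := ((eventually_lt_median K hs hsq hqp hl h).and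
    ((eventually_parallelogram_mem hU hu x y).and ((eventually_lt_modelDiam K (p + q)).and
      self_mem_nhdsWithin))).exists
  obtain ⟨v', m', hpair, hm⟩ := exists_isComparisonPair_of_hasMedian hline htrans hhom hε hs hqp
    (by linarith) hy hsub hadd hmem hd hmed
  refine ⟨_, _, v', m', hpair, ?_⟩
  rw [hm, τ_add_right_eq htrans, hhom ε x hε, hx, ← ENNReal.ofReal_mul hε.le]
  exact ENNReal.ofReal_lt_ofReal_iff'.2 ⟨hμ, (mul_pos hε hl).trans hμ⟩

/-- If the parallelogram law fails in the other direction, then some median in `U` is longer than its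
comparison median. -/
theorem exists_isComparisonPair_gt
    (hline : ∀ p v : X, LocallyLipschitz (fun t : ℝ => p + t • v))
    (htrans : ∀ x y z : X, S.τ (x + z) (y + z) = S.τ x y)
    (hhom : ∀ (c : ℝ) (x : X), 0 < c → S.τ 0 (c • x) = ENNReal.ofReal c * S.τ 0 x)
    (K : ℝ) {U : Set X} (hU : IsOpen U) {u : X} (hu : u ∈ U) {x y : X} {p q s l : ℝ}
    (hs : 0 < s) (hsq : s ≤ q) (hqp : q < p) (hl : 0 < l) (hx : S.τ 0 x = ENNReal.ofReal l)
    (hy : S.τ 0 y = ENNReal.ofReal s) (hsub : S.τ 0 (x - y) = ENNReal.ofReal (p - q))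
    (hadd : S.τ 0 (x + y) = ENNReal.ofReal (p + q))
    (h : p ^ 2 + q ^ 2 < s ^ 2 + l ^ 2) :
    ∃ v m v' m', S.IsComparisonPair K U v m v' m' ∧ modelTau K v' m' < S.τ v m := by
  obtain ⟨ε, ⟨μ, hmed, hμ⟩, hmem, hd, (hε : 0 < ε)⟩ := ((eventually_median_lt K hs hsq hqp hl h).and
    ((eventually_parallelogram_mem hU hu x y).and ((eventually_lt_modelDiam K (p + q)).and
      self_mem_nhdsWithin))).exists
  obtain ⟨v', m', hpair, hm⟩ := exists_isComparisonPair_of_hasMedian hline htrans hhom hε hs hqp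
    (by linarith) hy hsub hadd hmem hd hmed
  refine ⟨_, _, v', m', hpair, ?_⟩
  rw [hm, τ_add_right_eq htrans, hhom ε x hε, hx, ← ENNReal.ofReal_mul hε.le]
  exact (ENNReal.ofReal_lt_ofReal_iff (mul_pos hε hl)).2 hμ

/-- Both comparison inequalities fail in every non-empty open set: the median of the triangle
`0, x - y, x + y` is on one side of its Minkowski value, and then the median of the
triangle `0, 2 y, 2 x`, which belongs to the pair `x + y, x - y`, is on the other side. -/
theorem exists_isComparisonPair_lt_and_gt
    (hline : ∀ p v : X, LocallyLipschitz (fun t : ℝ => p + t • v))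
    (htrans : ∀ x y z : X, S.τ (x + z) (y + z) = S.τ x y)
    (hhom : ∀ (c : ℝ) (x : X), 0 < c → S.τ 0 (c • x) = ENNReal.ofReal c * S.τ 0 x)
    {x y : X} (hx : S.ll 0 x) (hy : S.ll 0 y) (hadd : S.ll 0 (x + y)) (hsub : S.ll 0 (x - y))
    (hne : 2 * S.τ 0 x ^ 2 + 2 * S.τ 0 y ^ 2 ≠ S.τ 0 (x + y) ^ 2 + S.τ 0 (x - y) ^ 2)
    (K : ℝ) {U : Set X} (hU : IsOpen U) (hne' : U.Nonempty) :
    (∃ v m v' m', S.IsComparisonPair K U v m v' m' ∧ S.τ v m < modelTau K v' m') ∧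
    (∃ v m v' m', S.IsComparisonPair K U v m v' m' ∧ modelTau K v' m' < S.τ v m) := by
  obtain ⟨u, hu⟩ := hne'
  obtain ⟨fx, fy, fa, fs⟩ := τ_ne_top_of_parallelogram_ne htrans hhom hx hy hadd hsub hne
  have hpos : ∀ {z : X}, S.ll 0 z → S.τ 0 z ≠ ⊤ →
      ∃ r : ℝ, 0 < r ∧ S.τ 0 z = ENNReal.ofReal r := fun {z} hz hf =>
    ⟨_, ENNReal.toReal_pos ((S.τ_pos_iff _ _).2 hz).ne' hf, (ENNReal.ofReal_toReal hf).symm⟩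
  obtain ⟨X₀, hX₀, eX⟩ := hpos hx fx
  obtain ⟨Y₀, hY₀, eY⟩ := hpos hy fy
  obtain ⟨A₀, hA₀, eA⟩ := hpos hadd fa
  obtain ⟨B₀, hB₀, eB⟩ := hpos hsub fs
  have e2X : S.τ 0 (x + y + (x - y)) = ENNReal.ofReal (2 * X₀) := by
    rw [show x + y + (x - y) = (2 : ℝ) • x by module, hhom 2 x two_pos, eX,
      ENNReal.ofReal_mul two_pos.le]
  have e2Y : S.τ 0 (x + y - (x - y)) = ENNReal.ofReal (2 * Y₀) := by
    rw [show x + y - (x - y) = (2 : ℝ) • y by module, hhom 2 y two_pos, eY,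
      ENNReal.ofReal_mul two_pos.le]
  have e22Y : S.τ 0 ((2 : ℝ) • y) = ENNReal.ofReal (2 * Y₀) := by
    rw [hhom 2 y two_pos, eY, ENNReal.ofReal_mul two_pos.le]
  have l2Y : S.ll 0 ((2 : ℝ) • y) := by
    rw [← S.τ_pos_iff, e22Y]; exact ENNReal.ofReal_pos.2 (by positivity)
  have l2Y' : S.ll 0 (x + y - (x - y)) := by
    rw [← S.τ_pos_iff, e2Y]; exact ENNReal.ofReal_pos.2 (by positivity)
  have i1 : B₀ + 2 * Y₀ ≤ A₀ := by
    have := τ_add_le htrans hsub l2Y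
    rwa [show x - y + (2 : ℝ) • y = x + y by module, eB, e22Y, eA,
      ← ENNReal.ofReal_add hB₀.le (by positivity), ENNReal.ofReal_le_ofReal_iff hA₀.le] at this
  have i2 : 2 * Y₀ + 2 * B₀ ≤ 2 * X₀ := by
    have := τ_add_le htrans hsub hy
    rw [sub_add_cancel, eB, eY, eX, ← ENNReal.ofReal_add hB₀.le hY₀.le,
      ENNReal.ofReal_le_ofReal_iff hX₀.le] at this
    linarith
  have hne₀ : 2 * X₀ ^ 2 + 2 * Y₀ ^ 2 ≠ A₀ ^ 2 + B₀ ^ 2 := by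
    intro h
    apply hne
    have h' := congrArg ENNReal.ofReal h
    rwa [ENNReal.ofReal_add (by positivity) (by positivity),
      ENNReal.ofReal_add (by positivity) (by positivity), ENNReal.ofReal_mul two_pos.le,
      ENNReal.ofReal_mul two_pos.le, ENNReal.ofReal_pow hX₀.le, ENNReal.ofReal_pow hY₀.le,
      ENNReal.ofReal_pow hA₀.le, ENNReal.ofReal_pow hB₀.le, ← eX, ← eY, ← eA, ← eB,
      ENNReal.ofReal_ofNat] at h'
  -- half sums and half differences of the sides at `0` of the two triangles
  have eA' : S.τ 0 (x + y) = ENNReal.ofReal ((A₀ + B₀) / 2 + (A₀ - B₀) / 2) := by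
    rw [eA]; congr 1; ring
  have eB' : S.τ 0 (x - y) = ENNReal.ofReal ((A₀ + B₀) / 2 - (A₀ - B₀) / 2) := by
    rw [eB]; congr 1; ring
  have e2X' : S.τ 0 (x + y + (x - y)) = ENNReal.ofReal ((X₀ + Y₀) + (X₀ - Y₀)) := by
    rw [e2X]; congr 1; ring
  have e2Y' : S.τ 0 (x + y - (x - y)) = ENNReal.ofReal ((X₀ + Y₀) - (X₀ - Y₀)) := by
    rw [e2Y]; congr 1; ring
  rcases hne₀.lt_or_gt with h | h
  · exact ⟨exists_isComparisonPair_lt hline htrans hhom K hU hu hY₀ (by linarith) (by linarith)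
      hX₀ eX eY eB' eA' (by nlinarith),
      exists_isComparisonPair_gt hline htrans hhom K hU hu hB₀ (by linarith) (by linarith)
      hA₀ eA eB e2Y' e2X' (by nlinarith)⟩
  · exact ⟨exists_isComparisonPair_lt hline htrans hhom K hU hu hB₀ (by linarith) (by linarith)
      hA₀ eA eB e2Y' e2X' (by nlinarith),
      exists_isComparisonPair_gt hline htrans hhom K hU hu hY₀ (by linarith) (by linarith)
      hX₀ eX eY eB' eA' (by nlinarith)⟩

end LorentzianPreLengthSpace

theorem lemma2 {X : Type*} [AddCommGroup X] [Module ℝ X] [MetricSpace X]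
    [IsTopologicalAddGroup X] [ContinuousSMul ℝ X]
    (hline : ∀ p v : X, LocallyLipschitz (fun t : ℝ => p + t • v))
    (S : LorentzianPreLengthSpace X)
    (htrans : ∀ x y z : X, S.τ (x + z) (y + z) = S.τ x y)
    (hhom : ∀ (c : ℝ) (x : X), 0 < c → S.τ 0 (c • x) = ENNReal.ofReal c * S.τ 0 x)
    (hpar : ∃ x y : X, S.ll 0 x ∧ S.ll 0 y ∧ S.ll 0 (x + y) ∧ S.ll 0 (x - y) ∧
      2 * S.τ 0 x ^ 2 + 2 * S.τ 0 y ^ 2 ≠ S.τ 0 (x + y) ^ 2 + S.τ 0 (x - y) ^ 2) :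
    (∀ K : ℝ, ¬ S.CurvatureBoundedBelow K ∧ ¬ S.CurvatureBoundedAbove K) ∧
    (∀ (K : ℝ) (U : Set X), IsOpen U → U.Nonempty →
      ¬ S.TriangleComparisonBelow K U ∧ ¬ S.TriangleComparisonAbove K U) := by
  obtain ⟨x, y, hx, hy, hadd, hsub, hne⟩ := hpar
  have key : ∀ (K : ℝ) (U : Set X), IsOpen U → U.Nonempty →
      ¬ S.TriangleComparisonBelow K U ∧ ¬ S.TriangleComparisonAbove K U := by
    intro K U hU hU'
    obtain ⟨⟨v, m, v', m', hp, hlt⟩, v₁, m₁, v₁', m₁', hp₁, hgt⟩ :=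
      LorentzianPreLengthSpace.exists_isComparisonPair_lt_and_gt hline htrans hhom hx hy hadd hsub
        hne K hU hU'
    exact ⟨fun h => hgt.not_ge (h v₁ m₁ v₁' m₁' hp₁).1, fun h => hlt.not_ge (h v m v' m' hp).1⟩
  refine ⟨fun K => ⟨fun h => ?_, fun h => ?_⟩, key⟩
  · obtain ⟨U, hU, h0, -, hT⟩ := h 0
    exact (key K U hU ⟨0, h0⟩).1 hT
  · obtain ⟨U, hU, h0, -, hT⟩ := h 0
    exact (key K U hU ⟨0, h0⟩).2 hT
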